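/- For a unital $C^*$-algebra $E$ and an integer $n\ge 2$, say that $E$ is generated by $n$ mutually unitarily equivalent and almost mutually orthogonal projections if for every $\varepsilon>0$ there are projections (self-adjoint idempotents) $p_1,\dots,p_n\in E$ such that (1) $p_1+\cdots+p_n$ is invertible in $E$; (2) the $C^*$-subalgebra of $E$ generated by $p_1,\dots,p_n$ is $E$; (3) for all $i\ne j$, $p_j=wp_iw^*$ for some unitary $w\in E$, and $\|p_ip_j\|<\varepsilon$. Let $\mathrm{Pgen}(E)$ be the least integer $k\ge 2$ such that $E$ is generated by $k$ mutually unitarily equivalent and almost mutually orthogonal projections, with $\mathrm{Pgen}(E)=\infty$ if there is no such $k$. Let $A$ be either a simple unital AF-algebra (that is, a nonzero unital $C^*$-algebra with no closed two-sided ideals other than $0$ and $A$ that is the closure of the union of an increasing sequence of finite-dimensional $C^*$-subalgebras), or an irrational rotation algebra (that is, for some irrational $\theta\in\mathbb R$, the universal unital $C^*$-algebra generated by two unitaries $u,v$ subject to $vu=e^{2\pi i\theta}uv$). Then the $C^*$-algebra $M_3(A)$ of $3\times 3$ matrices over $A$ satisfies $$\mathrm{Pgen}(M_3(A))\le 3 .$$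 -/

import Mathlib

universe u

/-- `Cstar M` is `C*(M)`: the smallest closed (not necessarily unital) `*`-subalgebra
containing `M`. -/
noncomputable def Cstar {E : Type u} [CStarAlgebra E] (M : Set E) : NonUnitalStarSubalgebra ℂ E :=
  (NonUnitalStarAlgebra.adjoin ℂ M).topologicalClosure

/-- Unitary equivalence of two elements of a unital C⋆-algebra. -/
def UnitarilyEquivalent {E : Type u} [CStarAlgebra E] (p q : E) : Prop :=
  ∃ w ∈ unitary E, q = w * p * star w

/-- `E` is generated by `n` mutually unitarily equivalent and almost mutually orthogonal
projections (the number `n` is fixed, the projections may depend on `ε`). -/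
def GeneratedByProjections (E : Type u) [CStarAlgebra E] (n : ℕ) : Prop :=
  ∀ ε : ℝ, 0 < ε → ∃ p : Fin n → E,
    (∀ i, IsStarProjection (p i)) ∧
    IsUnit (∑ i, p i) ∧
    Cstar (Set.range p) = ⊤ ∧
    ∀ i j, i ≠ j → UnitarilyEquivalent (p i) (p j) ∧ ‖p i * p j‖ < ε

/-- The least `k ≥ 2` such that `E` is generated by `k` mutually unitarily equivalent and almost
mutually orthogonal projections, and `⊤` if there is no such `k`. -/
noncomputable def Pgen (E : Type u) [CStarAlgebra E] : ℕ∞ :=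
  ⨅ k ∈ {k : ℕ | 2 ≤ k ∧ GeneratedByProjections E k}, (k : ℕ∞)

/-- A simple C⋆-algebra: nonzero, with no closed two-sided ideals other than `0` and itself. -/
def IsSimpleCStarAlgebra (A : Type u) [CStarAlgebra A] : Prop :=
  Nontrivial A ∧ ∀ I : TwoSidedIdeal A, IsClosed (I : Set A) → I = ⊥ ∨ I = ⊤

/-- An AF-algebra: the closure of the union of an increasing sequence of finite-dimensional
C⋆-subalgebras (which are not required to contain the unit). -/
def IsAFAlgebra (A : Type u) [CStarAlgebra A] : Prop :=
  ∃ F : ℕ → NonUnitalStarSubalgebra ℂ A,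
    Monotone F ∧ (∀ n, FiniteDimensional ℂ (F n)) ∧ Dense (⋃ n, (F n : Set A))

/-- `a` and `b` are unitaries with `b a = e^{2πiθ} a b`. -/
def IsRotationPair (θ : ℝ) {B : Type u} [CStarAlgebra B] (a b : B) : Prop :=
  a ∈ unitary B ∧ b ∈ unitary B ∧
    b * a = Complex.exp (2 * Real.pi * Complex.I * θ) • (a * b)

/-- `A` is (a copy of) the rotation algebra `A_θ`: the universal unital C⋆-algebra generated by two
unitaries `a`, `b` with `b a = e^{2πiθ} a b`. -/
def IsRotationAlgebra (θ : ℝ) (A : Type u) [CStarAlgebra A] : Prop :=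
  ∃ a b : A, IsRotationPair θ a b ∧ Cstar {a, b} = ⊤ ∧
    ∀ (B : Type u) [CStarAlgebra B] (a' b' : B), IsRotationPair θ a' b' →
      ∃ φ : A →⋆ₐ[ℂ] B, φ a = a' ∧ φ b = b'

/-!
The proof rests on two facts.

*Matrices.* If `A` is generated, as a closed unital `*`-algebra, by self-adjoint elements `h₁`,
`h₂` and a unitary `u`, then `M₃(A)` is generated by three unitarily equivalent and almost
orthogonal projections (`generatedByProjections_three`). Encode `h₁` in a small invertible "sine"
`s` with "cosine" `c = (1 - s²)^(1/2)`, such that `s²` generates `h₁` (`IsSinCos`), and `h₂` in `k`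
with cosine `l` in the same way. The three projections are those onto the columns `(1, 0, 0)`,
`(s, c, 0)` and `(u l k, k, l²)` of `A³`; they are the conjugates of the diagonal matrix units by
unitaries `1`, `rot₀₁`, `rot₂`. The columns are almost orthogonal because `s` and `k` are small,
they form an upper triangular invertible matrix, which makes the sum of the projections invertible,
and the entries of the projections successively yield `h₁`, `h₂`, `u` and all matrix units
(`CStarMatrix.eq_top_of_conj_mem`).

*Generators.* A rotation algebra is generated by the real and imaginary parts of its first unitary
and by its second unitary. An AF algebra is generated by a single element `x`, so that the real
and imaginary parts of `x` and `u = 1` will do (`exists_dense_adjoin_singleton`). Indeed, a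
finite-dimensional C⋆-algebra has a single generator (`exists_le_adjoin_singleton`), and then its
generators are dense in it, as generating is a Zariski open condition (`eventually_le_adjoin`).
In an AF algebra, the elements `x` whose `*`-algebra comes within a given distance of a given
element of one of the finite-dimensional subalgebras thus form an open dense set, and the Baire
category theorem applies to countably many of these sets.
-/

/-! ### Sines and cosines of self-adjoint elements -/

/-- Data of an invertible sine `s` and an invertible cosine `c`, with inverses `s'` and `c'`:
commuting self-adjoint contractions with `c² + s² = 1` such that every closed unital `*`-subalgebra
containing `s²` contains all four elements and the given element `h`. -/
structure IsSinCos {A : Type*} [CStarAlgebra A] (h s c s' c' : A) : Prop where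
  star_sin : star s = s
  star_cos : star c = c
  comm : c * s = s * c
  sq_add_sq : c * c + s * s = 1
  cos_inv_mul : c' * c = 1
  cos_mul_inv : c * c' = 1
  sin_inv_mul : s' * s = 1
  sin_mul_inv : s * s' = 1
  norm_cos_le : ‖c‖ ≤ 1
  norm_sin_le : ‖s‖ ≤ 1
  mem (S : StarSubalgebra ℂ A) (hS : IsClosed (S : Set A)) (hs : s * s ∈ S) :
    h ∈ S ∧ s ∈ S ∧ c ∈ S ∧ s' ∈ S ∧ c' ∈ S

/-- The sine is a small multiple of `‖h‖ + 1 + h`, so that it has strictly positive spectrum and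
`h` can be recovered from its square. -/
theorem IsSelfAdjoint.exists_isSinCos {A : Type*} [CStarAlgebra A] {h : A} (hh : IsSelfAdjoint h)
    {η : ℝ} (hη : 0 < η) : ∃ s c s' c' : A, IsSinCos h s c s' c' ∧ ‖s‖ ≤ η := by
  set M : ℝ := ‖h‖ + 1 with hM
  have hMpos : 0 < M := by positivity
  set m : ℝ := min η (1 / 2) with hm
  have hmpos : 0 < m := lt_min hη (by norm_num)
  have hmη : m ≤ η := min_le_left _ _
  have hm2 : m ≤ 1 / 2 := min_le_right _ _
  set σ : ℝ := m / (2 * M) with hσ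
  have hσpos : 0 < σ := by positivity
  have hσM : σ * (2 * M) = m := by rw [hσ]; field_simp
  set f : ℝ → ℝ := fun t => σ * (M + t) with hf
  set g : ℝ → ℝ := fun t => √(1 - f t * f t) with hg
  have hK : ∀ t ∈ spectrum ℝ h, 0 < M + t ∧ M + t ≤ 2 * M := by
    intro t ht
    have : Nontrivial A := by
      by_contra hA
      rw [not_nontrivial_iff_subsingleton] at hA
      simp [spectrum.of_subsingleton] at ht
    have h1 : ‖t‖ ≤ ‖h‖ := spectrum.norm_le_norm_of_mem ht
    rw [Real.norm_eq_abs, abs_le] at h1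
    constructor <;> linarith
  have hfpos : ∀ t ∈ spectrum ℝ h, 0 < f t := fun t ht => mul_pos hσpos (hK t ht).1
  have hfle : ∀ t ∈ spectrum ℝ h, f t ≤ m := fun t ht => by
    rw [← hσM]
    exact mul_le_mul_of_nonneg_left (hK t ht).2 hσpos.le
  have hff : ∀ t ∈ spectrum ℝ h, 0 < 1 - f t * f t := fun t ht => by
    nlinarith [hfpos t ht, hfle t ht]
  have hgpos : ∀ t ∈ spectrum ℝ h, 0 < g t := fun t ht => Real.sqrt_pos.2 (hff t ht)
  have cf : Continuous f := by fun_prop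
  have cg : Continuous g := by fun_prop
  have cf' : ContinuousOn (fun t => (f t)⁻¹) (spectrum ℝ h) :=
    cf.continuousOn.inv₀ fun t ht => (hfpos t ht).ne'
  have cg' : ContinuousOn (fun t => (g t)⁻¹) (spectrum ℝ h) :=
    cg.continuousOn.inv₀ fun t ht => (hgpos t ht).ne'
  have hss : cfc f h * cfc f h = cfc (fun t => f t * f t) h :=
    (cfc_mul f f h cf.continuousOn cf.continuousOn).symm
  refine ⟨cfc f h, cfc g h, cfc (fun t => (f t)⁻¹) h, cfc (fun t => (g t)⁻¹) h,
    ⟨cfc_predicate f h, cfc_predicate g h, cfc_commute_cfc g f h, ?_, ?_, ?_, ?_, ?_, ?_, ?_, ?_⟩, ?_⟩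
  · have hgg : cfc g h * cfc g h = cfc (fun t => g t * g t) h :=
      (cfc_mul g g h cg.continuousOn cg.continuousOn).symm
    rw [hss, hgg, ← cfc_add h (fun t => g t * g t) (fun t => f t * f t)
      (cg.mul cg).continuousOn (cf.mul cf).continuousOn, ← cfc_one ℝ h]
    refine cfc_congr fun t ht => ?_
    have := Real.mul_self_sqrt (hff t ht).le
    simp only [hg, this, Pi.one_apply]
    ring
  · rw [← cfc_mul _ _ h cg' cg.continuousOn, ← cfc_one ℝ h]
    exact cfc_congr fun t ht => inv_mul_cancel₀ (hgpos t ht).ne'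
  · rw [← cfc_mul _ _ h cg.continuousOn cg', ← cfc_one ℝ h]
    exact cfc_congr fun t ht => mul_inv_cancel₀ (hgpos t ht).ne'
  · rw [← cfc_mul _ _ h cf' cf.continuousOn, ← cfc_one ℝ h]
    exact cfc_congr fun t ht => inv_mul_cancel₀ (hfpos t ht).ne'
  · rw [← cfc_mul _ _ h cf.continuousOn cf', ← cfc_one ℝ h]
    exact cfc_congr fun t ht => mul_inv_cancel₀ (hfpos t ht).ne'
  · refine norm_cfc_le zero_le_one fun t ht => ?_
    rw [Real.norm_of_nonneg (hgpos t ht).le]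
    exact Real.sqrt_le_one.2 (by nlinarith [hfpos t ht])
  · refine norm_cfc_le zero_le_one fun t ht => ?_
    rw [Real.norm_of_nonneg (hfpos t ht).le]
    exact (hfle t ht).trans (hm2.trans (by norm_num))
  · intro S hS hs
    have key : h ∈ S := by
      have : cfc (fun τ => √τ / σ - M) (cfc f h * cfc f h) = h := by
        rw [hss, ← cfc_comp' (fun τ => √τ / σ - M) (fun t => f t * f t) h
          (by fun_prop) (cf.mul cf).continuousOn]
        conv_rhs => rw [← cfc_id ℝ h]
        refine cfc_congr fun t ht => ?_
        rw [Real.sqrt_mul_self (hfpos t ht).le]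
        simp only [id, hf]
        field_simp
        ring
      rw [← this]
      exact cfc_mem (hs := hS) _ hs
    exact ⟨key, cfc_mem (hs := hS) _ key, cfc_mem (hs := hS) _ key, cfc_mem (hs := hS) _ key,
      cfc_mem (hs := hS) _ key⟩
  · refine norm_cfc_le hη.le fun t ht => ?_
    rw [Real.norm_of_nonneg (hfpos t ht).le]
    exact (hfle t ht).trans hmη

/-! ### Matrix units, rotations and corners -/

namespace CStarMatrix

variable {A : Type*} [CStarAlgebra A]

/-- The `3 × 3` matrix with entry `x` at `(i, j)` and zeros elsewhere. -/
def single (i j : Fin 3) (x : A) : CStarMatrix (Fin 3) (Fin 3) A :=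
  ofMatrix (Matrix.single i j x)

theorem single_apply (i j k l : Fin 3) (x : A) :
    single i j x k l = if i = k ∧ j = l then x else 0 := rfl

theorem single_mul_single (i j k : Fin 3) (x y : A) :
    single i j x * single j k y = single i k (x * y) :=
  Matrix.single_mul_single_same ..

theorem single_add (i j : Fin 3) (x y : A) :
    single i j (x + y) = single i j x + single i j y :=
  Matrix.single_add ..

theorem single_smul (i j : Fin 3) (r : ℂ) (x : A) :
    single i j (r • x) = r • single i j x :=
  (Matrix.smul_single ..).symm

theorem star_single (i j : Fin 3) (x : A) : star (single i j x) = single j i (star x) :=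
  Matrix.conjTranspose_single ..

theorem single_zero (i j : Fin 3) : single i j (0 : A) = 0 := Matrix.single_zero ..

theorem eq_sum_single (M : CStarMatrix (Fin 3) (Fin 3) A) :
    M = ∑ i, ∑ j, single i j (M i j) :=
  Matrix.matrix_eq_sum_single M

theorem isStarProjection_single_one (i : Fin 3) : IsStarProjection (single i i (1 : A)) :=
  ⟨by rw [IsIdempotentElem, single_mul_single, mul_one],
    by rw [IsSelfAdjoint, star_single, star_one]⟩

theorem continuous_single [PartialOrder A] [StarOrderedRing A] (i j : Fin 3) :
    Continuous (single i j : A → CStarMatrix (Fin 3) (Fin 3) A) :=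
  continuous_pi fun k => continuous_pi fun l => by
    simp only [single_apply]
    split_ifs
    exacts [continuous_id, continuous_const]

/-- The diagonal case holds because `x ↦ x ⊗ eᵢᵢ` is a `*`-homomorphism; in general
`x ⊗ eᵢⱼ = (x ⊗ eᵢᵢ) (1 ⊗ eᵢⱼ)`. -/
theorem norm_single_le [PartialOrder A] [StarOrderedRing A] (i j : Fin 3) (x : A) :
    ‖single i j x‖ ≤ ‖x‖ := by
  have h1 : ‖single i i x‖ ≤ ‖x‖ := by
    let φ : A →⋆ₙₐ[ℂ] CStarMatrix (Fin 3) (Fin 3) A :=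
      { toFun := single i i
        map_smul' := fun r x => single_smul i i r x
        map_zero' := single_zero i i
        map_add' := single_add i i
        map_mul' := fun x y => (single_mul_single i i i x y).symm
        map_star' := fun x => (star_single i i x).symm }
    exact NonUnitalStarAlgHom.norm_apply_le φ x
  have h2 : ‖single i j (1 : A)‖ ≤ 1 := by
    have h3 : ‖single j j (1 : A)‖ ≤ 1 := (isStarProjection_single_one j).norm_le
    have h4 := CStarRing.norm_star_mul_self (x := single i j (1 : A))
    rw [star_single, single_mul_single, star_one, mul_one] at h4
    nlinarith [norm_nonneg (single i j (1 : A))]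
  calc ‖single i j x‖ = ‖single i i x * single i j 1‖ := by rw [single_mul_single, mul_one]
    _ ≤ ‖single i i x‖ * ‖single i j (1 : A)‖ := norm_mul_le _ _
    _ ≤ ‖x‖ * 1 := by gcongr
    _ = ‖x‖ := mul_one _

/-- The matrix of the transposition of `i` and `j` conjugates one matrix unit into the other. -/
theorem unitarilyEquivalent_single_one [PartialOrder A] [StarOrderedRing A] (i j : Fin 3) :
    UnitarilyEquivalent (single i i (1 : A)) (single j j 1) := by
  set σ := Equiv.swap i j
  have hσ : σ⁻¹ = σ := Equiv.swap_inv i j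
  let P : Matrix (Fin 3) (Fin 3) A := σ.permMatrix A
  have hP : P.conjTranspose = P := by
    rw [Matrix.conjTranspose_permMatrix, hσ]
  have hPP : P * P = 1 := by
    rw [← Matrix.permMatrix_mul, Equiv.swap_mul_self, Matrix.permMatrix_one]
  have key : P * Matrix.single i i 1 * P.conjTranspose = Matrix.single j j 1 := by
    rw [hP, PEquiv.toMatrix_toPEquiv_mul, PEquiv.mul_toMatrix_toPEquiv]
    ext k l
    simp only [Matrix.submatrix_apply, Matrix.single_apply, id]
    have : ∀ k, i = σ k ↔ j = k := fun k => by
      rw [eq_comm, ← Equiv.eq_symm_apply, eq_comm]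
      simp [σ]
    have h2 : σ.symm = σ := hσ
    simp [h2, this]
  refine ⟨ofMatrix P, ⟨?_, ?_⟩, key.symm⟩
  · change P.conjTranspose * P = 1
    rw [hP, hPP]
  · change P * P.conjTranspose = 1
    rw [hP, hPP]

theorem single_mul_mul_single (i j k l : Fin 3) (x y : A) (M : CStarMatrix (Fin 3) (Fin 3) A) :
    single i k x * M * single l j y = single i j (x * M k l * y) :=
  Matrix.single_mul_mul_single ..

/-- The unitary rotating the coordinates `0` and `1` in `A³`. -/
def rot₀₁ (s c : A) : CStarMatrix (Fin 3) (Fin 3) A := ofMatrix !![c, s, 0; -s, c, 0; 0, 0, 1]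

/-- A unitary with last column `(u c s, s, c²)`, the product of `diag (u, 1, 1)` and of rotations
of the coordinates `0, 2` and `1, 2` in `A³`. -/
def rot₂ (u s c : A) : CStarMatrix (Fin 3) (Fin 3) A :=
  ofMatrix !![u * c, -(u * s * s), u * c * s; 0, c, s; -s, -(c * s), c * c]

theorem rot₀₁_mem_unitary {h s c s' c' : A} (H : IsSinCos h s c s' c') :
    rot₀₁ s c ∈ unitary (CStarMatrix (Fin 3) (Fin 3) A) := by
  have h1 := H.sq_add_sq
  have h2 : s * s + c * c = 1 := by rw [add_comm, h1]
  constructor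
  · ext i j
    fin_cases i <;> fin_cases j <;>
      simp [rot₀₁, mul_apply, Fin.sum_univ_three, star_apply, H.star_sin, H.star_cos,
        H.comm, h1, h2]
  · ext i j
    fin_cases i <;> fin_cases j <;>
      simp [rot₀₁, mul_apply, Fin.sum_univ_three, star_apply, H.star_sin, H.star_cos,
        H.comm, h1, h2]

theorem rot₂_mem_unitary {h s c s' c' u : A} (H : IsSinCos h s c s' c') (hu : u ∈ unitary A) :
    rot₂ u s c ∈ unitary (CStarMatrix (Fin 3) (Fin 3) A) := by
  let D : CStarMatrix (Fin 3) (Fin 3) A := ofMatrix !![u, 0, 0; 0, 1, 0; 0, 0, 1]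
  let R : CStarMatrix (Fin 3) (Fin 3) A := ofMatrix !![c, 0, s; 0, 1, 0; -s, 0, c]
  let S : CStarMatrix (Fin 3) (Fin 3) A := ofMatrix !![1, 0, 0; 0, c, s; 0, -s, c]
  have h1 := H.sq_add_sq
  have h2 : s * s + c * c = 1 := by rw [add_comm, h1]
  have hD : D ∈ unitary (CStarMatrix (Fin 3) (Fin 3) A) := by
    constructor <;> ext i j <;> fin_cases i <;> fin_cases j <;>
      simp [D, mul_apply, Fin.sum_univ_three, star_apply, hu.1, hu.2]
  have hR : R ∈ unitary (CStarMatrix (Fin 3) (Fin 3) A) := by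
    constructor <;> ext i j <;> fin_cases i <;> fin_cases j <;>
      simp [R, mul_apply, Fin.sum_univ_three, star_apply, H.star_sin, H.star_cos,
        H.comm, h1, h2]
  have hS : S ∈ unitary (CStarMatrix (Fin 3) (Fin 3) A) := by
    constructor <;> ext i j <;> fin_cases i <;> fin_cases j <;>
      simp [S, mul_apply, Fin.sum_univ_three, star_apply, H.star_sin, H.star_cos,
        H.comm, h1, h2]
  have : rot₂ u s c = D * R * S := by
    ext i j
    fin_cases i <;> fin_cases j <;>
      simp [rot₂, D, R, S, mul_apply, Fin.sum_univ_three, mul_assoc, H.comm]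
  rw [this]
  exact mul_mem (mul_mem hD hR) hS

/-- The entries of the conjugate of a diagonal matrix unit only depend on one column of the
conjugating matrix. -/
theorem conj_single_apply (U : CStarMatrix (Fin 3) (Fin 3) A) (i k l : Fin 3) :
    (U * single i i 1 * star U : CStarMatrix (Fin 3) (Fin 3) A) k l = U k i * star (U l i) := by
  fin_cases i <;>
  simp [mul_apply, single_apply, star_apply, Fin.sum_univ_three]

variable [PartialOrder A] [StarOrderedRing A]

/-- The elements `x` of `A` such that the matrix `x ⊗ e₀₀` lies in a given `*`-subalgebra that
contains `1 ⊗ e₀₀`. -/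
def corner (C : NonUnitalStarSubalgebra ℂ (CStarMatrix (Fin 3) (Fin 3) A))
    (h1 : single 0 0 (1 : A) ∈ C) : StarSubalgebra ℂ A where
  carrier := {x | single 0 0 x ∈ C}
  mul_mem' {x y} (hx : single 0 0 x ∈ C) (hy : single 0 0 y ∈ C) :=
    show single 0 0 (x * y) ∈ C from single_mul_single 0 0 0 x y ▸ mul_mem hx hy
  one_mem' := h1
  add_mem' {x y} (hx : single 0 0 x ∈ C) (hy : single 0 0 y ∈ C) :=
    show single 0 0 (x + y) ∈ C from (single_add 0 0 x y).symm ▸ add_mem hx hy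
  zero_mem' := show single 0 0 (0 : A) ∈ C from (single_zero (A := A) 0 0).symm ▸ zero_mem C
  algebraMap_mem' r := show single 0 0 (algebraMap ℂ A r) ∈ C by
    rw [Algebra.algebraMap_eq_smul_one, single_smul]
    exact SMulMemClass.smul_mem r h1
  star_mem' {x} (hx : single 0 0 x ∈ C) :=
    show single 0 0 (star x) ∈ C from star_single 0 0 x ▸ star_mem hx

theorem isClosed_corner {C : NonUnitalStarSubalgebra ℂ (CStarMatrix (Fin 3) (Fin 3) A)}
    (hC : IsClosed (C : Set (CStarMatrix (Fin 3) (Fin 3) A))) (h1 : single 0 0 (1 : A) ∈ C) :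
    IsClosed (corner C h1 : Set A) :=
  hC.preimage (continuous_single 0 0)

theorem eq_top_of_matrixUnits {C : NonUnitalStarSubalgebra ℂ (CStarMatrix (Fin 3) (Fin 3) A)}
    (h : ∀ x : A, single 0 0 x ∈ C) (h1 : single 0 1 (1 : A) ∈ C)
    (h2 : single 0 2 (1 : A) ∈ C) : C = ⊤ := by
  have h0 : ∀ j, single 0 j (1 : A) ∈ C := by
    intro j
    fin_cases j
    exacts [h 1, h1, h2]
  refine eq_top_iff.2 fun M _ => ?_
  rw [eq_sum_single M]
  refine sum_mem fun i _ => sum_mem fun j _ => ?_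
  have := mul_mem (mul_mem (star_mem (h0 i)) (h (M i j))) (h0 j)
  simpa only [star_single, star_one, single_mul_single, one_mul, mul_one] using this

/-- The projections onto the columns `(1, 0, 0)`, `(s, c, 0)` and `(u l k, k, l²)` generate the
`3 × 3` matrices as soon as `h₁`, `h₂` and `u` generate `A`: the corner at `(0, 0)` contains `s²`,
hence `h₁`, `s` and `c`, so that the matrix unit `e₀₁` can be split off; then it contains `k²` and
`u l k²`, hence `h₂` and `u`, and `e₀₂` can be split off as well. -/
theorem eq_top_of_conj_mem {h₁ s c s' c' h₂ k l k' l' u : A}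
    (H : IsSinCos h₁ s c s' c') (K : IsSinCos h₂ k l k' l')
    (hgen : ∀ S : StarSubalgebra ℂ A, IsClosed (S : Set A) → h₁ ∈ S → h₂ ∈ S → u ∈ S → S = ⊤)
    {C : NonUnitalStarSubalgebra ℂ (CStarMatrix (Fin 3) (Fin 3) A)}
    (hC : IsClosed (C : Set (CStarMatrix (Fin 3) (Fin 3) A)))
    (h₀ : single 0 0 (1 : A) ∈ C)
    (h₁ : rot₀₁ s c * single 1 1 1 * star (rot₀₁ s c) ∈ C)
    (h₂ : rot₂ u k l * single 2 2 1 * star (rot₂ u k l) ∈ C) : C = ⊤ := by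
  obtain ⟨p, hp⟩ : ∃ p, p = rot₀₁ s c * single 1 1 1 * star (rot₀₁ s c) := ⟨_, rfl⟩
  obtain ⟨q, hq⟩ : ∃ q, q = rot₂ u k l * single 2 2 1 * star (rot₂ u k l) := ⟨_, rfl⟩
  rw [← hp] at h₁
  rw [← hq] at h₂
  have hpe : ∀ i j, p i j = rot₀₁ s c i 1 * star (rot₀₁ s c j 1) := fun i j => by
    rw [hp, conj_single_apply]
  have hqe : ∀ i j, q i j = rot₂ u k l i 2 * star (rot₂ u k l j 2) := fun i j => by
    rw [hq, conj_single_apply]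
  have hB := isClosed_corner hC h₀
  set B := corner C h₀
  have hBC : ∀ {x : A}, x ∈ B → single 0 0 x ∈ C := fun hx => hx
  -- The `(0, 0)` entry of the second projection is `s²`.
  obtain ⟨hh₁, hs, hc, hs', hc'⟩ := H.mem B hB (by
    have := mul_mem (mul_mem h₀ h₁) h₀
    rw [single_mul_mul_single, hpe] at this
    change single 0 0 _ ∈ C
    simpa [rot₀₁, H.star_sin] using this)
  -- Its `(0, 1)` entry is the invertible element `s c`.
  have e01 : single 0 1 (1 : A) ∈ C := by
    have hrow : single 0 0 (c' * s') * p = single 0 0 (c' * s' * (s * s)) + single 0 1 1 := by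
      ext i j
      have hx : c' * (s' * (s * c)) = 1 := by
        rw [← mul_assoc s', H.sin_inv_mul, one_mul, H.cos_inv_mul]
      fin_cases i <;> fin_cases j <;>
        simp [mul_apply, single_apply, hpe, rot₀₁, H.star_sin, H.star_cos,
          mul_assoc, hx]
    have hmem := sub_mem (mul_mem (hBC (mul_mem hc' hs')) h₁)
      (hBC (mul_mem (mul_mem hc' hs') (mul_mem hs hs)))
    rwa [hrow, add_sub_cancel_left] at hmem
  have e10 : single 1 0 (1 : A) ∈ C := by
    simpa only [star_single, star_one] using star_mem e01
  -- The `(1, 1)` entry of the third projection is `k²`.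
  obtain ⟨hh₂, hk, hl, hk', hl'⟩ := K.mem B hB (by
    have := mul_mem (mul_mem e01 h₂) e10
    rw [single_mul_mul_single, hqe] at this
    change single 0 0 _ ∈ C
    simpa [rot₂, K.star_sin] using this)
  -- Its `(0, 1)` entry is `u l k²`.
  have hu : u ∈ B := by
    have hmem := mul_mem (mul_mem h₀ h₂) e10
    rw [single_mul_mul_single, hqe] at hmem
    have hmem' : u * l * k * k ∈ B := by
      change single 0 0 _ ∈ C
      simpa [rot₂, K.star_sin] using hmem
    have := mul_mem (mul_mem (mul_mem hmem' hk') hk') hl'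
    rwa [mul_assoc _ k k', K.sin_mul_inv, mul_one, mul_assoc _ k k', K.sin_mul_inv, mul_one,
      mul_assoc u, K.cos_mul_inv, mul_one] at this
  have hBtop : ∀ x : A, x ∈ B := fun x => by
    rw [hgen B hB hh₁ hh₂ hu]
    exact StarSubalgebra.mem_top
  -- Its `(1, 2)` entry is the invertible element `k l²`.
  have e02 : single 0 2 (1 : A) ∈ C := by
    have hrow : single 0 1 (l' * (l' * k')) * q = single 0 0 (l' * (l' * k') * q 1 0)
        + single 0 1 (l' * (l' * k') * q 1 1) + single 0 2 1 := by
      ext i j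
      have hx : l' * (l' * (k' * (k * (l * l)))) = 1 := by
        rw [← mul_assoc k', K.sin_inv_mul, one_mul, ← mul_assoc l' l, K.cos_inv_mul, one_mul,
          K.cos_inv_mul]
      have hq12 : q 1 2 = k * (l * l) := by
        rw [hqe]
        simp [rot₂, K.star_cos]
      fin_cases i <;> fin_cases j <;>
        simp [mul_apply, single_apply, hq12, mul_assoc, hx]
    have e : ∀ x : A, single 0 1 x ∈ C := fun x => by
      simpa only [single_mul_single, mul_one] using mul_mem (hBC (hBtop x)) e01
    have hmem := sub_mem (sub_mem (mul_mem (e (l' * (l' * k'))) h₂)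
      (hBC (hBtop (l' * (l' * k') * q 1 0)))) (e (l' * (l' * k') * q 1 1))
    rwa [hrow, add_assoc, add_sub_cancel_left, add_sub_cancel_left] at hmem
  exact eq_top_of_matrixUnits hBtop e01 e02

/-- The product of two conjugated matrix units is as small as the inner product of the two columns
onto which they project. -/
theorem norm_conj_single_mul_conj_single_le {U V : CStarMatrix (Fin 3) (Fin 3) A}
    (hU : U ∈ unitary (CStarMatrix (Fin 3) (Fin 3) A))
    (hV : V ∈ unitary (CStarMatrix (Fin 3) (Fin 3) A)) (i j : Fin 3) :
    ‖U * single i i 1 * star U * (V * single j j 1 * star V)‖ ≤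
      ‖∑ k, star (U k i) * V k j‖ := by
  have h : U * single i i 1 * star U * (V * single j j 1 * star V) =
      U * single i j ((star U * V : CStarMatrix (Fin 3) (Fin 3) A) i j) * star V := by
    have : single i i 1 * (star U * V) * single j j 1 =
        single i j ((star U * V : CStarMatrix (Fin 3) (Fin 3) A) i j) := by
      rw [single_mul_mul_single, one_mul, mul_one]
    rw [← this]
    simp only [mul_assoc]
  rw [h, CStarRing.norm_mul_mem_unitary _ (Unitary.star_mem hV),
    CStarRing.norm_mem_unitary_mul _ hU]
  refine (norm_single_le _ _ _).trans_eq ?_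
  simp [mul_apply, star_apply]

end CStarMatrix

theorem isStarProjection_conj {E : Type*} [CStarAlgebra E] {U p : E} (hU : U ∈ unitary E)
    (hp : IsStarProjection p) : IsStarProjection (U * p * star U) := by
  refine ⟨?_, hp.isSelfAdjoint.conjugate U⟩
  have h1 : star U * (U * (p * star U)) = p * star U := by
    rw [← mul_assoc, Unitary.star_mul_self_of_mem hU, one_mul]
  rw [IsIdempotentElem]
  simp only [mul_assoc, h1]
  rw [← mul_assoc p, hp.isIdempotentElem.eq]

open CStarMatrix in
/-- If `A` is generated by two self-adjoint elements and a unitary, then `M₃(A)` is generated by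
three unitarily equivalent and almost orthogonal projections. -/
theorem generatedByProjections_three {A : Type*} [CStarAlgebra A] [PartialOrder A]
    [StarOrderedRing A] {h₁ h₂ u : A} (hh₁ : IsSelfAdjoint h₁) (hh₂ : IsSelfAdjoint h₂)
    (hu : u ∈ unitary A)
    (hgen : ∀ S : StarSubalgebra ℂ A, IsClosed (S : Set A) → h₁ ∈ S → h₂ ∈ S → u ∈ S → S = ⊤) :
    GeneratedByProjections (CStarMatrix (Fin 3) (Fin 3) A) 3 := by
  intro ε hε
  obtain ⟨s, c, s', c', H, hs⟩ := hh₁.exists_isSinCos (η := ε / 4) (by positivity)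
  obtain ⟨k, l, k', l', K, hk⟩ := hh₂.exists_isSinCos (η := ε / 4) (by positivity)
  let U : Fin 3 → CStarMatrix (Fin 3) (Fin 3) A := ![1, rot₀₁ s c, rot₂ u k l]
  have hU : ∀ i, U i ∈ unitary (CStarMatrix (Fin 3) (Fin 3) A) := by
    intro i
    fin_cases i
    exacts [one_mem _, rot₀₁_mem_unitary H, rot₂_mem_unitary K hu]
  let p : Fin 3 → CStarMatrix (Fin 3) (Fin 3) A := fun i => U i * single i i 1 * star (U i)
  have hp : ∀ i, IsStarProjection (p i) := fun i =>
    isStarProjection_conj (hU i) (isStarProjection_single_one i)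
  refine ⟨p, hp, ?_, ?_, fun i j hij => ⟨?_, ?_⟩⟩
  · -- The sum of the projections is `V * star V`, where `V` is upper triangular with invertible
    -- diagonal.
    let V : CStarMatrix (Fin 3) (Fin 3) A := ofMatrix !![1, s, u * l * k; 0, c, k; 0, 0, l * l]
    let W : CStarMatrix (Fin 3) (Fin 3) A :=
      ofMatrix !![1, -(s * c'), s * c' * k * l' * l' - u * l * k * l' * l';
        0, c', -(c' * k * l' * l'); 0, 0, l' * l']
    have hll : l * (l * (l' * l')) = 1 := by
      rw [← mul_assoc l l', K.cos_mul_inv, one_mul, K.cos_mul_inv]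
    have hll' : l' * (l' * (l * l)) = 1 := by
      rw [← mul_assoc l' l, K.cos_inv_mul, one_mul, K.cos_inv_mul]
    have hcc : ∀ x, c * (c' * x) = x := fun x => by rw [← mul_assoc, H.cos_mul_inv, one_mul]
    have hVW : V * W = 1 := by
      ext i j
      fin_cases i <;> fin_cases j <;>
        simp [V, W, mul_apply, Fin.sum_univ_three, mul_assoc, hll, hcc, H.cos_mul_inv]
      abel
    have hWV : W * V = 1 := by
      ext i j
      fin_cases i <;> fin_cases j <;>
        simp [V, W, mul_apply, Fin.sum_univ_three, mul_assoc, hll', H.cos_inv_mul, sub_mul]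
      abel
    have hV : IsUnit V := ⟨⟨V, W, hVW, hWV⟩, rfl⟩
    have hsum : ∑ i, p i = V * star V := by
      ext i j
      rw [Fin.sum_univ_three, CStarMatrix.add_apply, CStarMatrix.add_apply, mul_apply,
        Fin.sum_univ_three]
      simp only [p, conj_single_apply, star_apply]
      fin_cases i <;> fin_cases j <;> simp [U, V, rot₀₁, rot₂]
    rw [hsum]
    exact hV.mul hV.star
  · have hmem : ∀ i, p i ∈ Cstar (Set.range p) := fun i =>
      NonUnitalStarSubalgebra.le_topologicalClosure _
        (NonUnitalStarAlgebra.subset_adjoin ℂ _ (Set.mem_range_self i))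
    refine eq_top_of_conj_mem H K hgen (NonUnitalStarSubalgebra.isClosed_topologicalClosure _)
      ?_ (hmem 1) (hmem 2)
    simpa [p, U] using hmem 0
  · obtain ⟨P, hP, h⟩ := unitarilyEquivalent_single_one (A := A) i j
    refine ⟨U j * P * star (U i),
      mul_mem (mul_mem (hU j) hP) (Unitary.star_mem (hU i)), ?_⟩
    have h1 : ∀ X, star (U i) * (U i * X) = X := fun X => by
      rw [← mul_assoc, Unitary.star_mul_self_of_mem (hU i), one_mul]
    simp only [p, h, star_mul, star_star, mul_assoc, h1]
  · have hk' : ‖u * l * k‖ ≤ ε / 4 := by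
      rw [mul_assoc, CStarRing.norm_mem_unitary_mul _ hu]
      calc ‖l * k‖ ≤ ‖l‖ * ‖k‖ := norm_mul_le _ _
        _ ≤ 1 * (ε / 4) := by gcongr; exact K.norm_cos_le
        _ = ε / 4 := one_mul _
    have h01 : ‖p 0 * p 1‖ < ε := by
      refine (norm_conj_single_mul_conj_single_le (hU 0) (hU 1) 0 1).trans_lt ?_
      have : ‖s‖ < ε := by linarith
      simpa [Fin.sum_univ_three, U, rot₀₁] using this
    have h02 : ‖p 0 * p 2‖ < ε := by
      refine (norm_conj_single_mul_conj_single_le (hU 0) (hU 2) 0 2).trans_lt ?_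
      have : ‖u * l * k‖ < ε := by linarith
      simpa [Fin.sum_univ_three, U, rot₂] using this
    have h12 : ‖p 1 * p 2‖ < ε := by
      refine (norm_conj_single_mul_conj_single_le (hU 1) (hU 2) 1 2).trans_lt ?_
      have : ‖s * (u * l * k) + c * k‖ < ε := by
        calc ‖s * (u * l * k) + c * k‖ ≤ ‖s‖ * ‖u * l * k‖ + ‖c‖ * ‖k‖ :=
              (norm_add_le _ _).trans (add_le_add (norm_mul_le _ _) (norm_mul_le _ _))
          _ ≤ 1 * (ε / 4) + 1 * (ε / 4) := by
              gcongr
              exacts [H.norm_sin_le, H.norm_cos_le]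
          _ < ε := by linarith
      simpa [Fin.sum_univ_three, U, rot₀₁, rot₂, H.star_sin, H.star_cos] using this
    have hsymm : ∀ i j, ‖p i * p j‖ = ‖p j * p i‖ := fun i j => by
      rw [← norm_star, star_mul, (hp i).isSelfAdjoint, (hp j).isSelfAdjoint]
    have h10 := (hsymm 1 0).trans_lt h01
    have h20 := (hsymm 2 0).trans_lt h02
    have h21 := (hsymm 2 1).trans_lt h12
    fin_cases i <;> fin_cases j
    exacts [absurd rfl hij, h01, h02, h10, absurd rfl hij, h12, h20, h21, absurd rfl hij]

/-! ### Finite-dimensional C⋆-algebras are singly generated -/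

section FiniteDimensional

variable {A : Type*} [CStarAlgebra A] (F : StarSubalgebra ℂ A)

theorem StarSubalgebra.isClosed_of_finiteDimensional [FiniteDimensional ℂ F] :
    IsClosed (F : Set A) :=
  have : FiniteDimensional ℂ F.toSubalgebra.toSubmodule := ‹FiniteDimensional ℂ F›
  F.toSubalgebra.toSubmodule.closed_of_finiteDimensional

variable {F}

theorem finite_spectrum_of_mem [FiniteDimensional ℂ F] {x : A} (hx : x ∈ F) :
    (spectrum ℝ x).Finite := by
  have hint : IsIntegral ℂ x :=
    (Algebra.IsIntegral.isIntegral (R := ℂ) (⟨x, hx⟩ : F)).map F.subtype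
  obtain ⟨P, hP, hPx⟩ := hint
  have hfin : (spectrum ℂ x).Finite := by
    refine (P.roots.toFinset.finite_toSet).subset fun z hz => ?_
    have h1 := spectrum.subset_polynomial_aeval x P ⟨z, hz, rfl⟩
    have h2 : Polynomial.aeval x P = 0 := hPx
    have : Nontrivial A := by
      by_contra hA
      rw [not_nontrivial_iff_subsingleton] at hA
      simp [spectrum.of_subsingleton] at hz
    rw [h2, spectrum.zero_eq] at h1
    simpa [hP.ne_zero, Polynomial.IsRoot] using h1
  rw [← spectrum.preimage_algebraMap (S := ℂ)]
  exact hfin.preimage (algebraMap ℝ ℂ).injective.injOn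

/-- The projection is the spectral projection of `x` at a nonzero point of its finite spectrum. -/
theorem IsSelfAdjoint.exists_eigenprojection [FiniteDimensional ℂ F] {x : A} (hx : x ∈ F)
    (hsa : IsSelfAdjoint x) (hx0 : x ≠ 0) :
    ∃ r : ℝ, ∃ q ∈ F, r ≠ 0 ∧ IsStarProjection q ∧ q ≠ 0 ∧ x * q = r • q := by
  obtain ⟨r, hr, hr0⟩ : ∃ r ∈ spectrum ℝ x, r ≠ 0 := by
    by_contra! h
    refine hx0 ?_
    rw [← cfc_id ℝ x, cfc_congr (f := id) (g := fun _ => (0 : ℝ)) fun t ht => h t ht]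
    simp
  have hfin := finite_spectrum_of_mem hx
  set f : ℝ → ℝ := fun t => if t = r then 1 else 0 with hf
  have hcf : ContinuousOn f (spectrum ℝ x) := hfin.continuousOn f
  have hmul : x * cfc f x = r • cfc f x := by
    conv_lhs => enter [1]; rw [← cfc_id ℝ x]
    rw [← cfc_mul id f x continuousOn_id hcf, ← cfc_smul r f x hcf]
    refine cfc_congr fun t ht => ?_
    by_cases h : t = r <;> simp [hf, h]
  refine ⟨r, cfc f x, cfc_mem (hs := F.isClosed_of_finiteDimensional) f hx, hr0,
    ⟨?_, cfc_predicate f x⟩, fun h0 => ?_, hmul⟩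
  · rw [IsIdempotentElem, ← cfc_mul f f x hcf hcf]
    refine cfc_congr fun t ht => ?_
    by_cases h : t = r <;> simp [hf, h]
  · have h1 : (1 : ℝ) ∈ spectrum ℝ (cfc f x) := by
      rw [cfc_map_spectrum f x]
      exact ⟨r, hr, by simp [hf]⟩
    have : Nontrivial A := by
      by_contra hA
      rw [not_nontrivial_iff_subsingleton] at hA
      simp [spectrum.of_subsingleton] at hr
    rw [h0, spectrum.zero_eq] at h1
    simp at h1

variable (F) in
/-- A finite set of nonzero, mutually orthogonal projections in `F`. -/
structure IsOrthogonalFamily (s : Finset A) : Prop where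
  mem {e : A} (he : e ∈ s) : e ∈ F
  isStarProjection {e : A} (he : e ∈ s) : IsStarProjection e
  ne_zero {e : A} (he : e ∈ s) : e ≠ 0
  mul_eq_zero {e f : A} (he : e ∈ s) (hf : f ∈ s) (hef : e ≠ f) : e * f = 0

theorem IsOrthogonalFamily.card_le [FiniteDimensional ℂ F] {s : Finset A}
    (hs : IsOrthogonalFamily F s) : s.card ≤ Module.finrank ℂ F := by
  let v : s → F := fun e => ⟨e, hs.mem e.2⟩
  have hv : LinearIndependent ℂ v := by
    refine Fintype.linearIndependent_iff.2 fun g hg e => ?_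
    have h1 : ∑ i, g i • (i : A) = 0 := by
      simpa [v] using congrArg Subtype.val hg
    have h2 := congrArg (· * (e : A)) h1
    simp only [Finset.sum_mul, zero_mul, smul_mul_assoc] at h2
    rw [Finset.sum_eq_single e (fun i _ hi => by
      rw [hs.mul_eq_zero i.2 e.2 fun h => hi (Subtype.ext h), smul_zero]) (by simp),
      (hs.isStarProjection e.2).isIdempotentElem.eq] at h2
    exact (smul_eq_zero.1 h2).resolve_right (hs.ne_zero e.2)
  simpa using hv.fintype_card_le_finrank

theorem exists_maximal_isOrthogonalFamily [FiniteDimensional ℂ F] :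
    ∃ s : Finset A, IsOrthogonalFamily F s ∧
      ∀ t : Finset A, IsOrthogonalFamily F t → t.card ≤ s.card := by
  let N : Set ℕ := {n | ∃ s : Finset A, IsOrthogonalFamily F s ∧ s.card = n}
  have hne : N.Nonempty := ⟨0, ∅, ⟨by simp, by simp, by simp, by simp⟩, rfl⟩
  have hbdd : BddAbove N := ⟨Module.finrank ℂ F, by rintro _ ⟨s, hs, rfl⟩; exact hs.card_le⟩
  obtain ⟨s, hs, hcard⟩ := Nat.sSup_mem hne hbdd
  exact ⟨s, hs, fun t ht => hcard ▸ le_csSup hbdd ⟨t, ht, rfl⟩⟩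

variable {s : Finset A}

namespace IsOrthogonalFamily

theorem sum_mul (hs : IsOrthogonalFamily F s) {e : A} (he : e ∈ s) : (∑ f ∈ s, f) * e = e := by
  rw [Finset.sum_mul, Finset.sum_eq_single e (fun f hf hfe => hs.mul_eq_zero hf he hfe)
    (fun h => absurd he h), (hs.isStarProjection he).isIdempotentElem.eq]

theorem mul_sum (hs : IsOrthogonalFamily F s) {e : A} (he : e ∈ s) : e * (∑ f ∈ s, f) = e := by
  rw [Finset.mul_sum, Finset.sum_eq_single e (fun f hf hfe => hs.mul_eq_zero he hf hfe.symm)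
    (fun h => absurd he h), (hs.isStarProjection he).isIdempotentElem.eq]

open Classical in
theorem insert (hs : IsOrthogonalFamily F s) {q : A} (hq : q ∈ F) (hqp : IsStarProjection q)
    (hq0 : q ≠ 0) (horth : ∀ e ∈ s, e * q = 0) : IsOrthogonalFamily F (insert q s) := by
  have horth' : ∀ e ∈ s, q * e = 0 := fun e he => by
    have := congrArg star (horth e he)
    rwa [star_mul, star_zero, (hs.isStarProjection he).isSelfAdjoint, hqp.isSelfAdjoint] at this
  refine ⟨fun {e} he => ?_, fun {e} he => ?_, fun {e} he => ?_, fun {e f} he hf hef => ?_⟩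
  · rcases Finset.mem_insert.1 he with rfl | he
    exacts [hq, hs.mem he]
  · rcases Finset.mem_insert.1 he with rfl | he
    exacts [hqp, hs.isStarProjection he]
  · rcases Finset.mem_insert.1 he with rfl | he
    exacts [hq0, hs.ne_zero he]
  · rcases Finset.mem_insert.1 he with rfl | he' <;>
      rcases Finset.mem_insert.1 hf with rfl | hf'
    exacts [absurd rfl hef, horth' _ hf', horth _ he', hs.mul_eq_zero he' hf' hef]

theorem notMem_of_orthogonal (hs : IsOrthogonalFamily F s) {q : A} (horth : ∀ e ∈ s, e * q = 0) :
    q ∉ s := fun h => hs.ne_zero h <| by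
  rw [← (hs.isStarProjection h).isIdempotentElem.eq, horth q h]

/-- A maximal family sums to `1`: otherwise `1` minus the sum could be added to it. -/
theorem sum_eq_one (hs : IsOrthogonalFamily F s)
    (hmax : ∀ t : Finset A, IsOrthogonalFamily F t → t.card ≤ s.card) : ∑ e ∈ s, e = 1 := by
  classical
  by_contra hne
  have hsum : IsStarProjection (∑ e ∈ s, e) := by
    refine ⟨?_, ?_⟩
    · rw [IsIdempotentElem, Finset.mul_sum]
      exact Finset.sum_congr rfl fun e he => hs.sum_mul he
    · rw [IsSelfAdjoint, star_sum]
      exact Finset.sum_congr rfl fun e he => (hs.isStarProjection he).isSelfAdjoint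
  have horth : ∀ e ∈ s, e * (1 - ∑ f ∈ s, f) = 0 := fun e he => by
    rw [mul_sub, mul_one, hs.mul_sum he, sub_self]
  have hins := hs.insert (q := 1 - ∑ f ∈ s, f)
    (sub_mem (one_mem F) (sum_mem fun e he => hs.mem he)) hsum.one_sub
    (sub_ne_zero.2 (Ne.symm hne)) horth
  have := hmax _ hins
  rw [Finset.card_insert_of_notMem (hs.notMem_of_orthogonal horth)] at this
  omega

/-- A projection of a maximal family is minimal: otherwise it could be split into `q` and
`e - q`. -/
theorem eq_of_mul_eq (hs : IsOrthogonalFamily F s)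
    (hmax : ∀ t : Finset A, IsOrthogonalFamily F t → t.card ≤ s.card) {e q : A} (he : e ∈ s)
    (hq : q ∈ F) (hqp : IsStarProjection q) (hq0 : q ≠ 0) (heq : e * q = q) : q = e := by
  classical
  by_contra hne
  have hqe : q * e = q := by
    have := congrArg star heq
    rwa [star_mul, (hs.isStarProjection he).isSelfAdjoint, hqp.isSelfAdjoint] at this
  have herase : IsOrthogonalFamily F (s.erase e) :=
    ⟨fun h => hs.mem (Finset.mem_of_mem_erase h),
      fun h => hs.isStarProjection (Finset.mem_of_mem_erase h),
      fun h => hs.ne_zero (Finset.mem_of_mem_erase h),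
      fun h h' => hs.mul_eq_zero (Finset.mem_of_mem_erase h) (Finset.mem_of_mem_erase h')⟩
  have ho1 : ∀ f ∈ s.erase e, f * q = 0 := fun f hf => by
    rw [← heq, ← mul_assoc, hs.mul_eq_zero (Finset.mem_of_mem_erase hf) he
      (Finset.ne_of_mem_erase hf), zero_mul]
  have h1 := herase.insert hq hqp hq0 ho1
  have hee := (hs.isStarProjection he).isIdempotentElem.eq
  have hpp : IsStarProjection (e - q) := by
    refine ⟨?_, (hs.isStarProjection he).isSelfAdjoint.sub hqp.isSelfAdjoint⟩
    rw [IsIdempotentElem, mul_sub, sub_mul, sub_mul, hee, hqe, heq, hqp.isIdempotentElem.eq]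
    simp
  have ho2 : ∀ f ∈ Insert.insert q (s.erase e), f * (e - q) = 0 := fun f hf => by
    rcases Finset.mem_insert.1 hf with rfl | hf
    · rw [mul_sub, hqe, hqp.isIdempotentElem.eq, sub_self]
    · rw [mul_sub, ho1 f hf, hs.mul_eq_zero (Finset.mem_of_mem_erase hf) he
        (Finset.ne_of_mem_erase hf), sub_self]
  have h2 := h1.insert (sub_mem (hs.mem he) hq) hpp (sub_ne_zero.2 (Ne.symm hne)) ho2
  have := hmax _ h2
  rw [Finset.card_insert_of_notMem (h1.notMem_of_orthogonal ho2),
    Finset.card_insert_of_notMem (herase.notMem_of_orthogonal ho1),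
    Finset.card_erase_of_mem he] at this
  have := Finset.card_pos.2 ⟨e, he⟩
  omega

/-- The corners of the projections in a maximal orthogonal family are one-dimensional. -/
theorem exists_eq_smul (hs : IsOrthogonalFamily F s) [FiniteDimensional ℂ F]
    (hmax : ∀ t : Finset A, IsOrthogonalFamily F t → t.card ≤ s.card) {e x : A} (he : e ∈ s)
    (hx : x ∈ F) (hex : e * x = x) (hxe : x * e = x) : ∃ c : ℂ, x = c • e := by
  have hsa : ∀ y ∈ F, IsSelfAdjoint y → e * y = y → y * e = y → ∃ c : ℂ, y = c • e := by
    intro y hy hysa hey hye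
    by_cases hy0 : y = 0
    · exact ⟨0, by simp [hy0]⟩
    obtain ⟨r, q, hq, hr, hqp, hq0, hyq⟩ := hysa.exists_eigenprojection hy hy0
    have heq : e * q = q := by
      have h1 : q = r⁻¹ • (y * q) := by rw [hyq, smul_smul, inv_mul_cancel₀ hr, one_smul]
      rw [h1, mul_smul_comm, ← mul_assoc, hey]
    have hqe := hs.eq_of_mul_eq hmax he hq hqp hq0 heq
    rw [hqe, hye] at hyq
    exact ⟨r, by rw [hyq]; simp⟩
  have hestar := (hs.isStarProjection he).isSelfAdjoint.star_eq
  have hex' : e * star x = star x := by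
    have := congrArg star hxe
    rwa [star_mul, hestar] at this
  have hxe' : star x * e = star x := by
    have := congrArg star hex
    rwa [star_mul, hestar] at this
  obtain ⟨a, ha⟩ := hsa (x + star x) (add_mem hx (star_mem hx)) (IsSelfAdjoint.add_star_self x)
    (by rw [mul_add, hex, hex']) (by rw [add_mul, hxe, hxe'])
  obtain ⟨b, hb⟩ := hsa (Complex.I • (x - star x))
    (SMulMemClass.smul_mem _ (sub_mem hx (star_mem hx)))
    (by simp [IsSelfAdjoint, star_smul, ← smul_neg])
    (by rw [mul_smul_comm, mul_sub, hex, hex']) (by rw [smul_mul_assoc, sub_mul, hxe, hxe'])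
  refine ⟨(1 / 2) * (a - Complex.I * b), ?_⟩
  have : x = (1 / 2 : ℂ) • ((x + star x) - Complex.I • (Complex.I • (x - star x))) := by
    rw [smul_smul, Complex.I_mul_I, neg_one_smul]
    module
  rw [this, ha, hb]
  module

/-- If `x` and `y` lie in `e F f` and `x ≠ 0`, then `x⋆ x` and `y x⋆` are multiples of `f` and of
`e`, and `y x⋆ x` is a multiple of both `x` and `y`. -/
theorem exists_eq_smul_of_ne_zero (hs : IsOrthogonalFamily F s) [FiniteDimensional ℂ F]
    (hmax : ∀ t : Finset A, IsOrthogonalFamily F t → t.card ≤ s.card) {e f x y : A} (he : e ∈ s)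
    (hf : f ∈ s) (hx : x ∈ F) (hex : e * x = x) (hxf : x * f = x) (hx0 : x ≠ 0)
    (hy : y ∈ F) (hey : e * y = y) (hyf : y * f = y) : ∃ c : ℂ, y = c • x := by
  have hestar := (hs.isStarProjection he).isSelfAdjoint.star_eq
  have hfstar := (hs.isStarProjection hf).isSelfAdjoint.star_eq
  have hfx : f * star x = star x := by
    have := congrArg star hxf
    rwa [star_mul, hfstar] at this
  have hxe : star x * e = star x := by
    have := congrArg star hex
    rwa [star_mul, hestar] at this
  obtain ⟨a, ha⟩ := hs.exists_eq_smul hmax hf (mul_mem (star_mem hx) hx)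
    (by rw [← mul_assoc, hfx]) (by rw [mul_assoc, hxf])
  obtain ⟨b, hb⟩ := hs.exists_eq_smul hmax he (mul_mem hy (star_mem hx))
    (by rw [← mul_assoc, hey]) (by rw [mul_assoc, hxe])
  have ha0 : a ≠ 0 := by
    rintro rfl
    rw [zero_smul, CStarRing.star_mul_self_eq_zero_iff] at ha
    exact hx0 ha
  have h1 : a • y = b • x := by
    calc a • y = y * (star x * x) := by rw [ha, mul_smul_comm, hyf]
      _ = b • x := by rw [← mul_assoc, hb, smul_mul_assoc, hex]
  exact ⟨a⁻¹ * b, by rw [mul_smul, ← h1, smul_smul, inv_mul_cancel₀ ha0, one_smul]⟩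

/-- For `e`, `f` in a maximal orthogonal family, `e F f` is spanned by a single element. -/
theorem exists_spanning (hs : IsOrthogonalFamily F s) [FiniteDimensional ℂ F]
    (hmax : ∀ t : Finset A, IsOrthogonalFamily F t → t.card ≤ s.card) {e f : A} (he : e ∈ s)
    (hf : f ∈ s) : ∃ v ∈ F, e * v = v ∧ v * f = v ∧ ∀ x ∈ F, ∃ c : ℂ, e * x * f = c • v := by
  have hee := (hs.isStarProjection he).isIdempotentElem.eq
  have hff := (hs.isStarProjection hf).isIdempotentElem.eq
  by_cases h : ∀ x ∈ F, e * x * f = 0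
  · exact ⟨0, zero_mem F, by simp, by simp, fun x hx => ⟨0, by simp [h x hx]⟩⟩
  · push Not at h
    obtain ⟨w, hw, hw0⟩ := h
    have hmem : ∀ x ∈ F, e * x * f ∈ F := fun x hx => mul_mem (mul_mem (hs.mem he) hx) (hs.mem hf)
    have hl : ∀ x, e * (e * x * f) = e * x * f := fun x => by
      rw [← mul_assoc, ← mul_assoc, hee]
    have hr : ∀ x, e * x * f * f = e * x * f := fun x => by rw [mul_assoc, hff]
    exact ⟨e * w * f, hmem w hw, hl w, hr w, fun x hx =>
      hs.exists_eq_smul_of_ne_zero hmax he hf (hmem w hw) (hl w) (hr w) hw0 (hmem x hx) (hl x)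
        (hr x)⟩

end IsOrthogonalFamily

/-- A polynomial in a combination of orthogonal projections acts on each of them by its value at
the coefficient. -/
theorem aeval_sum_smul_mul {n : ℕ} {e : Fin n → A} (c : Fin n → ℂ)
    (hidem : ∀ i, e i * e i = e i) (horth : ∀ i j, i ≠ j → e i * e j = 0)
    (P : Polynomial ℂ) (k : Fin n) :
    Polynomial.aeval (∑ i, c i • e i) P * e k = P.eval (c k) • e k := by
  have hd : (∑ i, c i • e i) * e k = c k • e k := by
    rw [Finset.sum_mul, Finset.sum_eq_single k (fun i _ hi => by
      rw [smul_mul_assoc, horth i k hi, smul_zero]) (by simp), smul_mul_assoc, hidem]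
  induction P using Polynomial.induction_on' with
  | add p q hp hq => rw [map_add, add_mul, hp, hq, Polynomial.eval_add, add_smul]
  | monomial m a =>
    have hpow : (∑ i, c i • e i) ^ m * e k = c k ^ m • e k := by
      induction m with
      | zero => simp
      | succ m ih => rw [pow_succ, mul_assoc, hd, mul_smul_comm, ih, smul_smul, pow_succ']
    rw [Polynomial.aeval_monomial, Polynomial.eval_monomial, mul_assoc, hpow,
      Algebra.algebraMap_eq_smul_one, smul_mul_assoc, one_mul, smul_smul]

/-- A finite-dimensional C⋆-algebra is singly generated. With a maximal orthogonal family `e₀, e₁, …`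
and a spanning vector `vᵢⱼ` of each `eᵢ F eⱼ`, the real part `∑ i • eᵢ` of the generator yields the
projections, which cut the `vᵢⱼ` out of its imaginary part. -/
theorem exists_le_adjoin_singleton [FiniteDimensional ℂ F] :
    ∃ x ∈ F, F ≤ StarAlgebra.adjoin ℂ {x} := by
  obtain ⟨s, hs, hmax⟩ := exists_maximal_isOrthogonalFamily (F := F)
  set n := s.card
  let e : Fin n → A := fun i => (s.equivFin.symm i : A)
  have hes : ∀ i, e i ∈ s := fun i => (s.equivFin.symm i).2
  have hidem : ∀ i, e i * e i = e i := fun i =>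
    (hs.isStarProjection (hes i)).isIdempotentElem.eq
  have hestar : ∀ i, star (e i) = e i := fun i => (hs.isStarProjection (hes i)).isSelfAdjoint
  have horth : ∀ i j, i ≠ j → e i * e j = 0 := fun i j hij =>
    hs.mul_eq_zero (hes i) (hes j) fun h => hij (s.equivFin.symm.injective (Subtype.ext h))
  have hsum : ∑ i, e i = 1 := by
    rw [← hs.sum_eq_one hmax, ← Finset.sum_coe_sort s]
    exact Equiv.sum_comp s.equivFin.symm (fun a : s => (a : A))
  have hv : ∀ i j, ∃ v ∈ F, e i * v = v ∧ v * e j = v ∧ ∀ x ∈ F, ∃ c : ℂ, e i * x * e j = c • v :=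
    fun i j => hs.exists_spanning hmax (hes i) (hes j)
  choose v hvF hev hve hspan using hv
  set d : A := ∑ i : Fin n, ((i : ℕ) : ℂ) • e i with hd
  set y : A := ∑ i, ∑ j, if i < j then v i j else 0 with hy
  have hdF : d ∈ F := sum_mem fun i _ => SMulMemClass.smul_mem _ (hs.mem (hes i))
  have hyF : y ∈ F := sum_mem fun i _ => sum_mem fun j _ => by
    split_ifs
    exacts [hvF i j, zero_mem F]
  have hdsa : star d = d := by simp [hd, star_sum, star_smul, hestar]
  have hcut : ∀ i j, e i * y * e j = if i < j then v i j else 0 := by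
    intro i j
    have h1 : ∀ k l, e i * (if k < l then v k l else 0) * e j =
        if i = k ∧ j = l then (if k < l then v k l else 0) else 0 := by
      intro k l
      by_cases hkl : k < l
      · rw [if_pos hkl, ← hev k l, ← hve k l]
        by_cases hik : i = k
        · by_cases hjl : j = l
          · subst hik hjl
            simp [hev, hve]
          · rw [if_neg fun h => hjl h.2, mul_assoc, mul_assoc, mul_assoc, horth l j (Ne.symm hjl)]
            simp
        · rw [if_neg fun h => hik h.1, ← mul_assoc, horth i k hik]
          simp
      · simp [hkl]
    simp only [hy, Finset.mul_sum, Finset.sum_mul, h1, ite_and]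
    simp
  refine ⟨d + Complex.I • (y + star y), add_mem hdF (SMulMemClass.smul_mem _
    (add_mem hyF (star_mem hyF))), ?_⟩
  set x := d + Complex.I • (y + star y) with hx
  set G := StarAlgebra.adjoin ℂ {x}
  have hxG : x ∈ G := StarAlgebra.self_mem_adjoin_singleton ℂ x
  have hxstar : star x = d - Complex.I • (y + star y) := by
    simp [hx, hdsa, star_smul, add_comm, sub_eq_add_neg]
  have hdG : d ∈ G := by
    have : d = (1 / 2 : ℂ) • (x + star x) := by
      rw [hxstar, hx]
      module
    rw [this]
    exact SMulMemClass.smul_mem _ (add_mem hxG (star_mem hxG))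
  have hwG : y + star y ∈ G := by
    have : y + star y = (-Complex.I) • (x - d) := by
      rw [hx, add_sub_cancel_left, smul_smul]
      simp
    rw [this]
    exact SMulMemClass.smul_mem _ (sub_mem hxG hdG)
  have heG : ∀ i, e i ∈ G := by
    intro i
    -- The Lagrange polynomial that is `1` at the `i`th eigenvalue of `d` and `0` at the others.
    let P := Lagrange.interpolate Finset.univ (fun j : Fin n => ((j : ℕ) : ℂ)) (Pi.single i 1)
    have hP : Polynomial.aeval d P = e i := by
      have hinj : Set.InjOn (fun j : Fin n => ((j : ℕ) : ℂ)) (Finset.univ : Finset (Fin n)) :=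
        fun a _ b _ h => Fin.ext (Nat.cast_injective h)
      rw [← mul_one (Polynomial.aeval d P), ← hsum, Finset.mul_sum]
      have h1 : ∀ k, Polynomial.aeval d P * e k = (Pi.single i 1 : Fin n → ℂ) k • e k := fun k => by
        rw [← Lagrange.eval_interpolate_at_node (Pi.single i 1) hinj (Finset.mem_univ k)]
        exact aeval_sum_smul_mul (fun j : Fin n => ((j : ℕ) : ℂ)) hidem horth P k
      simp [h1, Pi.single_apply]
    rw [← hP]
    exact Algebra.adjoin_le (S := G.toSubalgebra) (Set.singleton_subset_iff.2 hdG)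
      (Polynomial.aeval_mem_adjoin_singleton ℂ d)
  have hvG : ∀ i j, i < j → v i j ∈ G := by
    intro i j hij
    have h1 : e i * (y + star y) * e j = v i j := by
      have h2 : e i * star y * e j = 0 := by
        have := congrArg star (hcut j i)
        rw [if_neg hij.not_gt] at this
        simpa [hestar, mul_assoc] using this
      rw [mul_add, add_mul, hcut, if_pos hij, h2, add_zero]
    rw [← h1]
    exact mul_mem (mul_mem (heG i) hwG) (heG j)
  intro z hz
  have hz' : z = ∑ i, ∑ j, e i * z * e j := by
    simp only [← Finset.mul_sum, hsum, mul_one, ← Finset.sum_mul, one_mul]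
  rw [hz']
  refine sum_mem fun i _ => sum_mem fun j _ => ?_
  rcases lt_trichotomy i j with h | rfl | h
  · obtain ⟨c, hc⟩ := hspan i j z hz
    rw [hc]
    exact SMulMemClass.smul_mem _ (hvG i j h)
  · obtain ⟨c, hc⟩ := hs.exists_eq_smul hmax (hes i)
      (mul_mem (mul_mem (hs.mem (hes i)) hz) (hs.mem (hes i)))
      (by rw [← mul_assoc, ← mul_assoc, hidem]) (by rw [mul_assoc, hidem])
    change e i * z * e i = c • e i at hc
    rw [hc]
    exact SMulMemClass.smul_mem _ (heG i)
  · obtain ⟨c, hc⟩ := hspan j i (star z) (star_mem hz)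
    have h1 : e i * z * e j = star (c • v j i) := by
      rw [← hc]
      simp [hestar, mul_assoc]
    rw [h1]
    exact star_mem (SMulMemClass.smul_mem _ (hvG j i h))

end FiniteDimensional

/-! ### Generic elements are generators -/

open scoped Topology

/-- The `*`-algebra generated by `X t` consists of the values at `t` of the `*`-algebra of functions
generated by `X`, whose members play the role of noncommutative `*`-polynomials. -/
theorem StarAlgebra.mem_adjoin_apply_iff {T A : Type*} [CStarAlgebra A] (X : T → A) (t : T) {y : A} :
    y ∈ StarAlgebra.adjoin ℂ {X t} ↔ ∃ g ∈ StarAlgebra.adjoin ℂ {X}, g t = y := by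
  have h := StarAlgHom.map_adjoin (R := ℂ) (Pi.evalStarAlgHom ℂ (fun _ : T => A) t) {X}
  rw [Set.image_singleton] at h
  change _ = StarAlgebra.adjoin ℂ {X t} at h
  rw [← h]
  exact Iff.rfl

theorem continuous_of_mem_adjoin {A : Type*} [CStarAlgebra A] {g : A → A}
    (hg : g ∈ StarAlgebra.adjoin ℂ {(id : A → A)}) : Continuous g := by
  induction hg using StarAlgebra.adjoin_induction with
  | mem x hx => rw [Set.mem_singleton_iff.1 hx]; exact continuous_id
  | algebraMap r => exact continuous_const
  | add x y _ _ hx hy => exact hx.add hy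
  | mul x y _ _ hx hy => exact hx.mul hy
  | star x _ hx => exact hx.star

theorem analyticAt_of_mem_adjoin {A : Type*} [CStarAlgebra A] {X : ℝ → A} {t : ℝ}
    (hX : AnalyticAt ℝ X t) {g : ℝ → A} (hg : g ∈ StarAlgebra.adjoin ℂ {X}) :
    AnalyticAt ℝ g t := by
  induction hg using StarAlgebra.adjoin_induction with
  | mem x hx => rwa [Set.mem_singleton_iff.1 hx]
  | algebraMap r => exact analyticAt_const
  | add x y _ _ hx hy => exact hx.add hy
  | mul x y _ _ hx hy => exact hx.mul hy
  | star x _ hx => exact ((starL' ℝ : A ≃L[ℝ] A).toContinuousLinearMap.analyticAt _).comp hx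

/-- If `x₀` generates the finite-dimensional algebra `F`, then so do the points `x + t (x₀ - x)`
for all small `t ≠ 0`: for suitable `*`-polynomials `gⱼ`, the determinant of the coordinates of
the values `gⱼ (x + t (x₀ - x))` is an analytic function of `t` that equals `1` at `t = 1`. -/
theorem eventually_le_adjoin {A : Type*} [CStarAlgebra A] {F : StarSubalgebra ℂ A}
    [FiniteDimensional ℂ F] {x₀ x : A} (hx₀ : x₀ ∈ F) (hgen : F ≤ StarAlgebra.adjoin ℂ {x₀})
    (hx : x ∈ F) :
    ∀ᶠ t : ℝ in 𝓝[≠] 0, F ≤ StarAlgebra.adjoin ℂ {x + t • (x₀ - x)} := by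
  set X : ℝ → A := fun t => x + t • (x₀ - x) with hX
  have hXF : ∀ t, X t ∈ F := fun t =>
    add_mem hx (by
      rw [← Complex.coe_smul]
      exact SMulMemClass.smul_mem _ (sub_mem hx₀ hx))
  have hXan : ∀ t, AnalyticAt ℝ X t := fun t =>
    analyticAt_const.add (analyticAt_id.smul analyticAt_const)
  have hX1 : X 1 = x₀ := by simp [hX]
  have hle : ∀ t, StarAlgebra.adjoin ℂ {X t} ≤ F := fun t =>
    StarAlgebra.adjoin_le (Set.singleton_subset_iff.2 (hXF t))
  set b := Module.finBasis ℂ F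
  have hg : ∀ i, ∃ g ∈ StarAlgebra.adjoin ℂ {X}, g 1 = (b i : A) := fun i => by
    rw [← StarAlgebra.mem_adjoin_apply_iff, hX1]
    exact hgen (b i).2
  choose g hgmem hg1 using hg
  have hgt : ∀ i t, g i t ∈ StarAlgebra.adjoin ℂ {X t} := fun i t =>
    (StarAlgebra.mem_adjoin_apply_iff X t).2 ⟨g i, hgmem i, rfl⟩
  -- Continuous extensions to `A` of the coordinate functionals of `F`.
  have hφ : ∀ i, ∃ φ : StrongDual ℂ A, ∀ y : F, φ y = b.coord i y := fun i => by
    obtain ⟨φ, hφ, -⟩ := exists_extension_norm_eq F.toSubalgebra.toSubmodule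
      (LinearMap.toContinuousLinearMap (b.coord i))
    exact ⟨φ, hφ⟩
  choose φ hφ using hφ
  set M : ℝ → Matrix _ _ ℂ := fun t => Matrix.of fun i j => φ i (g j t) with hM
  have hMan : ∀ t, AnalyticAt ℝ (fun t => (M t).det) t := fun t => by
    simp only [Matrix.det_apply']
    refine Finset.analyticAt_fun_sum _ fun σ _ => analyticAt_const.mul
      (Finset.analyticAt_fun_prod _ fun i _ => ?_)
    exact (((φ (σ i)).restrictScalars ℝ).analyticAt _).comp
      (analyticAt_of_mem_adjoin (hXan t) (hgmem i))
  have hM1 : (M 1).det = 1 := by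
    have : M 1 = 1 := by
      ext i j
      simp [hM, hg1, hφ, Matrix.one_apply, Finsupp.single_apply, eq_comm]
    rw [this, Matrix.det_one]
  have hev : ∀ᶠ t in 𝓝[≠] (0 : ℝ), (M t).det ≠ 0 := by
    refine (hMan 0).eventually_eq_zero_or_eventually_ne_zero.resolve_left fun h0 => ?_
    have := AnalyticOnNhd.eqOn_zero_of_preconnected_of_eventuallyEq_zero
      (fun t _ => hMan t) isPreconnected_univ (Set.mem_univ 0) h0 (Set.mem_univ 1)
    simp [hM1] at this
  filter_upwards [hev] with t ht
  let v : Fin (Module.finrank ℂ F) → F := fun i => ⟨g i t, hle t (hgt i t)⟩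
  have hv : LinearIndependent ℂ v := by
    refine Fintype.linearIndependent_iff.2 fun c hc => ?_
    have h1 : ∑ i, c i • g i t = 0 := by
      simpa [v] using congrArg Subtype.val hc
    have h2 : Matrix.mulVec (M t) c = 0 := by
      ext i
      have := congrArg (φ i) h1
      simpa [Matrix.mulVec, dotProduct, hM, mul_comm] using this
    exact congrFun (Matrix.eq_zero_of_mulVec_eq_zero ht h2)
  have hspan := hv.span_eq_top_of_card_eq_finrank' (by simp)
  intro y hy
  have hy' : (⟨y, hy⟩ : F) ∈ Submodule.span ℂ (Set.range v) := by
    rw [hspan]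
    trivial
  obtain ⟨c, hc⟩ := (Submodule.mem_span_range_iff_exists_fun ℂ).1 hy'
  have hc' : ∑ i, c i • g i t = y := by simpa [v] using congrArg Subtype.val hc
  rw [← hc']
  exact sum_mem fun i _ => SMulMemClass.smul_mem _ (hgt i t)

theorem finiteDimensional_adjoin {A : Type*} [CStarAlgebra A] (F : NonUnitalStarSubalgebra ℂ A)
    [FiniteDimensional ℂ F] : FiniteDimensional ℂ (StarAlgebra.adjoin ℂ (F : Set A)) := by
  have h := NonUnitalStarSubalgebra.unitization_range F
  rw [← h]
  have : FiniteDimensional ℂ (Unitization ℂ F) := by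
    refine Module.Finite.of_surjective
      ((Algebra.linearMap ℂ (Unitization ℂ F)).coprod (Unitization.inrHom ℂ ℂ F)) fun z => ?_
    exact ⟨(z.fst, z.snd), Unitization.inl_fst_add_inr_snd_eq z⟩
  exact inferInstanceAs (FiniteDimensional ℂ
    (LinearMap.range (NonUnitalStarSubalgebra.unitization F).toAlgHom.toLinearMap))

/-- The closure of an increasing union of finite-dimensional `*`-subalgebras is singly generated:
by the Baire category theorem, elements generating a dense `*`-subalgebra are even generic. -/
theorem exists_dense_adjoin_singleton {A : Type*} [CStarAlgebra A]
    {F : ℕ → StarSubalgebra ℂ A} (hF : Monotone F) [∀ n, FiniteDimensional ℂ (F n)]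
    (hdense : Dense (⋃ n, (F n : Set A))) :
    ∃ x : A, ∀ S : StarSubalgebra ℂ A, IsClosed (S : Set A) → x ∈ S → S = ⊤ := by
  let b := fun n => Module.finBasis ℂ (F n)
  -- The elements whose `*`-algebra comes `1 / (m + 1)`-close to a given basis vector of `F n`.
  let U : (Σ n, Fin (Module.finrank ℂ (F n)) × ℕ) → Set A := fun k =>
    {x | ∃ y ∈ StarAlgebra.adjoin ℂ {x}, ‖(b k.1 k.2.1 : A) - y‖ < 1 / (k.2.2 + 1 : ℝ)}
  have hUopen : ∀ k, IsOpen (U k) := fun k => by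
    have : U k = ⋃ g ∈ StarAlgebra.adjoin ℂ {(id : A → A)},
        {x | ‖(b k.1 k.2.1 : A) - g x‖ < 1 / (k.2.2 + 1 : ℝ)} := by
      ext x
      simp only [Set.mem_iUnion, exists_prop]
      constructor
      · rintro ⟨y, hy, hlt⟩
        obtain ⟨g, hg, rfl⟩ := (StarAlgebra.mem_adjoin_apply_iff id x).1 hy
        exact ⟨g, hg, hlt⟩
      · rintro ⟨g, hg, hlt⟩
        exact ⟨g x, (StarAlgebra.mem_adjoin_apply_iff id x).2 ⟨g, hg, rfl⟩, hlt⟩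
    rw [this]
    refine isOpen_biUnion fun g hg => ?_
    exact isOpen_lt (continuous_const.sub (continuous_of_mem_adjoin hg)).norm continuous_const
  have hUdense : ∀ k, Dense (U k) := fun k => by
    refine dense_iff_closure_eq.2 (Set.eq_univ_of_univ_subset ?_)
    rw [← hdense.closure_eq]
    refine closure_minimal (Set.iUnion_subset fun n x hx => ?_) isClosed_closure
    set N := max n k.1
    have hxN : x ∈ F N := hF (le_max_left _ _) hx
    have hbN : (b k.1 k.2.1 : A) ∈ F N := hF (le_max_right _ _) (b k.1 k.2.1).2
    obtain ⟨x₀, hx₀, hgen⟩ := exists_le_adjoin_singleton (F := F N)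
    have hev := eventually_le_adjoin hx₀ hgen hxN
    have htend : Filter.Tendsto (fun t : ℝ => x + t • (x₀ - x)) (nhdsWithin 0 {0}ᶜ) (nhds x) := by
      have : Continuous fun t : ℝ => x + t • (x₀ - x) := by fun_prop
      simpa using (this.tendsto 0).mono_left nhdsWithin_le_nhds
    refine mem_closure_of_tendsto htend (hev.mono fun t ht => ?_)
    exact ⟨b k.1 k.2.1, ht hbN, by simpa using by positivity⟩
  obtain ⟨x, hx⟩ := (dense_iInter_of_isOpen hUopen hUdense).nonempty
  refine ⟨x, fun S hS hxS => ?_⟩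
  have hadj : StarAlgebra.adjoin ℂ {x} ≤ S :=
    StarAlgebra.adjoin_le (Set.singleton_subset_iff.2 hxS)
  have hbS : ∀ n i, (b n i : A) ∈ S := fun n i => by
    rw [← SetLike.mem_coe, ← hS.closure_eq, Metric.mem_closure_iff]
    intro ε hε
    obtain ⟨m, hm⟩ := exists_nat_one_div_lt hε
    obtain ⟨y, hy, hlt⟩ := Set.mem_iInter.1 hx ⟨n, i, m⟩
    exact ⟨y, hadj hy, by rw [dist_eq_norm]; exact hlt.trans hm⟩
  have hFS : ∀ n, (F n : Set A) ⊆ S := fun n z hz => by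
    have h1 := congrArg Subtype.val ((b n).sum_repr ⟨z, hz⟩)
    have h2 : ∑ i, (b n).repr ⟨z, hz⟩ i • (b n i : A) = z := by
      simpa [-Module.Basis.sum_repr] using h1
    rw [← h2]
    exact sum_mem fun i _ => SMulMemClass.smul_mem _ (hbS n i)
  refine SetLike.coe_injective (Set.eq_univ_of_univ_subset ?_)
  rw [← hdense.closure_eq]
  exact closure_minimal (Set.iUnion_subset hFS) hS

/-! ### Projections generating `M₃(A)` -/

open scoped ComplexStarModule

theorem corollary3p4 (A : Type u) [CStarAlgebra A] [PartialOrder A] [StarOrderedRing A]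
    (hA : (IsSimpleCStarAlgebra A ∧ IsAFAlgebra A) ∨
      ∃ θ : ℝ, Irrational θ ∧ IsRotationAlgebra θ A) :
    Pgen (CStarMatrix (Fin 3) (Fin 3) A) ≤ 3 := by
  refine iInf₂_le_of_le 3 ⟨by norm_num, ?_⟩ le_rfl
  have hmem : ∀ (S : StarSubalgebra ℂ A) (x : A), (ℜ x : A) ∈ S → (ℑ x : A) ∈ S → x ∈ S :=
    fun S x hr hi => by
      rw [← realPart_add_I_smul_imaginaryPart x]
      exact add_mem hr (SMulMemClass.smul_mem _ hi)
  -- An AF algebra has a single generator; for a rotation algebra the first unitary is split into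
  -- its real and imaginary parts.
  rcases hA with ⟨-, F, hF, hfin, hdense⟩ | ⟨θ, -, a, b, ⟨ha, hb, -⟩, hab, -⟩
  · have hfin' : ∀ n, FiniteDimensional ℂ (StarAlgebra.adjoin ℂ (F n : Set A)) := fun n =>
      finiteDimensional_adjoin (F n)
    obtain ⟨x, hx⟩ := exists_dense_adjoin_singleton
      (F := fun n => StarAlgebra.adjoin ℂ (F n : Set A))
      (fun m n h => StarAlgebra.adjoin_mono (hF h))
      (hdense.mono (Set.iUnion_mono fun n => StarAlgebra.subset_adjoin ℂ _))
    exact generatedByProjections_three (ℜ x).2 (ℑ x).2 (one_mem _)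
      fun S hS hr hi _ => hx S hS (hmem S x hr hi)
  · refine generatedByProjections_three (ℜ a).2 (ℑ a).2 hb fun S hS hr hi hbS => ?_
    have haS := hmem S a hr hi
    let S' : NonUnitalStarSubalgebra ℂ A := S.toNonUnitalStarSubalgebra
    have hle : Cstar {a, b} ≤ S' := by
      refine NonUnitalStarSubalgebra.topologicalClosure_minimal _
        (NonUnitalStarAlgebra.adjoin_le ?_) hS
      rintro y (rfl | rfl)
      exacts [haS, hbS]
    rw [hab] at hle
    exact eq_top_iff.2 fun y _ => hle (NonUnitalStarAlgebra.mem_top (R := ℂ) (x := y))
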